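/- Let $(R,\mathfrak m,\mathbf k)$ be a Noetherian complete local normal domain of Krull dimension $d\ge 2$ and of equal characteristic, i.e. $\operatorname{char} R=\operatorname{char}\mathbf k$. Let $\mathfrak q_1,\dots,\mathfrak q_r$ ($r\ge 0$) be height-one prime ideals of $R$. Then there is a sequence $(\mathbf x_n)_{n\in\mathbb N}$ of nonzero elements of $R$ such that the principal ideals $\mathbf x_nR$ are pairwise distinct (so that they form an infinite set of nonzero principal ideals) and, for every $n$, $\mathbf x_n\notin\mathfrak q_1\cup\dots\cup\mathfrak q_r$ and the ring $R/\mathbf x_nR$ is reduced. -/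

import Mathlib

/-! A hypersurface in a normal domain is reduced as soon as `f` and `D f` lie in no common prime of
height at most one, for some derivation `D`. Indeed, if `R/f` is not reduced, an associated prime `p
= (f : s)` of its nilradical contains `s`. By normality `p` is locally principal, so `s t = f u`
with `t ∈ p` and `u ∉ p`. Thus `f` lies in the square of `p` locally at `p`, and `D f ∈ p`.

Since the dimension is at least two, there are `a, b` in the maximal ideal with no common prime of
height at most one. Take a nonzero derivation `D`, constants `c n` of `D`, and the pencil `f n = a -
c n * b`. The Wronskian `w = b * D a - a * D b` equals `b * D (f n) - f n * D b`, so it does not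
depend on `n`. Once `w ≠ 0`, a prime witnessing non-reducedness is one of the finitely many minimal
primes over `w`. Each of these, like each `q i`, contains at most one `f n`, so discarding finitely
many `n` suffices.

The derivation comes from Cohen's structure theorem: `R` is finite over a power series ring on a
coefficient field. If the extension of fraction fields is separable, a partial derivative extends;
if not, there is a nonzero derivation over the smaller field. Finiteness allows denominators to be
cleared. -/

/-! ### Non-reduced hypersurfaces and derivations -/

/-- If `R ⧸ (f)` is not reduced, some prime of the form `((f) : s)` contains `s`. -/
theorem exists_prime_colon_of_not_isReduced {R : Type*} [CommRing R] [IsNoetherianRing R] {f : R}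
    (h : ¬ IsReduced (R ⧸ Ideal.span {f})) :
    ∃ (p : Ideal R) (s : R), p.IsPrime ∧ (∀ x, x ∈ p ↔ f ∣ s * x) ∧ s ∈ p := by
  have hN : Nontrivial (nilradical (R ⧸ Ideal.span {f})) := by
    rw [Submodule.nontrivial_iff_ne_bot]
    exact fun h0 => h (nilradical_eq_bot_iff.mp h0)
  -- An associated prime of the nilradical, rather than of the whole quotient, makes `s` nilpotent
  -- modulo `f`, hence a member of the prime.
  obtain ⟨P, hP⟩ := associatedPrimes.nonempty (R ⧸ Ideal.span {f})
    (nilradical (R ⧸ Ideal.span {f}))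
  obtain ⟨hPp, ⟨s', hs'⟩, hPs⟩ := isAssociatedPrime_iff.mp hP
  obtain ⟨s, rfl⟩ := Ideal.Quotient.mk_surjective s'
  refine ⟨P.comap (Ideal.Quotient.mk _), s, hPp.comap _, fun x => ?_, ?_⟩
  · rw [Ideal.mem_comap, hPs, Submodule.mem_colon_singleton, Submodule.mem_bot,
      ← Ideal.mem_span_singleton, ← Ideal.Quotient.eq_zero_iff_mem, map_mul, mul_comm,
      ← Subtype.coe_inj]
    rfl
  · obtain ⟨n, hn⟩ := mem_nilradical.mp hs'
    exact hPp.mem_of_pow_mem n (hn ▸ P.zero_mem)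

/-- In a normal Noetherian domain, a prime `((f) : s)` is locally principal. -/
theorem exists_mul_eq_mul_of_prime_colon {R : Type*} [CommRing R] [IsDomain R]
    [IsNoetherianRing R] [IsIntegrallyClosed R] {f s : R} (hf : f ≠ 0) {p : Ideal R}
    [hp : p.IsPrime] (h : ∀ x, x ∈ p ↔ f ∣ s * x) :
    ∃ t ∈ p, ∃ u ∉ p, s * t = f * u := by
  by_contra! hcon
  have hf' : algebraMap R (FractionRing R) f ≠ 0 := by simpa using hf
  have hfp : f ∈ p := (h f).mpr (dvd_mul_left _ _)
  -- If the claim fails, `s * p ⊆ f * p`, so `s / f` stabilises the finitely generated nonzero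
  -- module `p` and is integral. By normality `f ∣ s`, which puts `1` in `p`.
  have hint : IsIntegral R (algebraMap R (FractionRing R) s / algebraMap R (FractionRing R) f) := by
    refine isIntegral_of_smul_mem_submodule (Submodule.map (Algebra.linearMap R (FractionRing R)) p) ?_
      (Submodule.FG.map _ (IsNoetherian.noetherian p)) _ ?_
    · intro h0
      have : algebraMap R (FractionRing R) f ∈ Submodule.map (Algebra.linearMap R (FractionRing R)) p := ⟨f, hfp, rfl⟩
      rw [h0] at this
      exact hf' (by simpa using this)
    · rintro _ ⟨x, hx, rfl⟩
      obtain ⟨u, hu⟩ := (h x).mp hx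
      refine ⟨u, by_contra fun hup => hcon x hx u hup hu, ?_⟩
      have := congrArg (algebraMap R (FractionRing R)) hu
      simp only [map_mul] at this
      simp only [Algebra.linearMap_apply, smul_eq_mul]
      field_simp
      linear_combination -this
  obtain ⟨y, hy⟩ := IsIntegrallyClosed.algebraMap_eq_of_integral hint
  have : s = f * y := by
    apply IsFractionRing.injective R (FractionRing R)
    rw [map_mul, hy, mul_div_cancel₀ _ hf']
  exact hp.ne_top ((Ideal.eq_top_iff_one _).mpr ((h 1).mpr ⟨y, by rw [mul_one, this]⟩))

/-- If `R` is a normal Noetherian domain and `R ⧸ (f)` is not reduced, then some prime of height at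
most one contains `f` together with all derivatives of `f`. -/
theorem exists_prime_derivation_mem_of_not_isReduced {R : Type*} [CommRing R] [IsDomain R]
    [IsNoetherianRing R] [IsIntegrallyClosed R] {f : R} (hf : f ≠ 0)
    (h : ¬ IsReduced (R ⧸ Ideal.span {f})) (D : Derivation ℤ R R) :
    ∃ p : Ideal R, p.IsPrime ∧ p.height ≤ 1 ∧ f ∈ p ∧ D f ∈ p := by
  obtain ⟨p, s, hp, hps, hs⟩ := exists_prime_colon_of_not_isReduced h
  obtain ⟨t, ht, u, hu, hst⟩ := exists_mul_eq_mul_of_prime_colon hf hps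
  have hfp : f ∈ p := (hps f).mpr (dvd_mul_left _ _)
  refine ⟨p, hp, ?_, hfp, ?_⟩
  -- `p` is minimal over `t`: for `x ∈ p`, `s * x = f * y` gives `u * x = t * y`, and `u` lies
  -- outside every prime below `p`.
  · refine Ideal.height_le_one_of_isPrincipal_of_mem_minimalPrimes (Ideal.span {t}) p
      ⟨⟨hp, (Ideal.span_singleton_le_iff_mem _).mpr ht⟩, ?_⟩
    rintro P ⟨hP, htP⟩ hPp x hx
    obtain ⟨y, hy⟩ := (hps x).mp hx
    have hux : u * x = t * y := by
      apply mul_left_cancel₀ hf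
      linear_combination -x * hst + t * hy
    exact (hP.mem_or_mem (hux ▸ P.mul_mem_right y ((Ideal.span_singleton_le_iff_mem _).mp htP) :
      u * x ∈ P)).resolve_left fun h => hu (hPp h)
  · have h1 : D (s * t) = D (f * u) := by rw [hst]
    simp only [Derivation.leibniz, smul_eq_mul] at h1
    have h2 : u * D f = s * D t + t * D s - f * D u := by linear_combination -h1
    refine (hp.mem_or_mem (?_ : u * D f ∈ p)).resolve_left hu
    rw [h2]
    exact p.sub_mem (p.add_mem (p.mul_mem_right _ hs) (p.mul_mem_right _ ht))
      (p.mul_mem_right _ hfp)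

/-! ### The pencil `a - c n * b` and its Wronskian -/

/-- A Noetherian local domain of dimension at least two has two nonzero elements of the maximal
ideal that lie in no common prime of height at most one. -/
theorem exists_pair_notMem_prime {R : Type*} [CommRing R] [IsDomain R] [IsLocalRing R]
    [IsNoetherianRing R] (hdim : 2 ≤ ringKrullDim R) :
    ∃ a b : R, a ∈ IsLocalRing.maximalIdeal R ∧ b ∈ IsLocalRing.maximalIdeal R ∧ b ≠ 0 ∧
      ∀ p : Ideal R, p.IsPrime → p.height ≤ 1 → a ∈ p → b ∉ p := by
  have hm : 2 ≤ (IsLocalRing.maximalIdeal R).height := by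
    rw [← IsLocalRing.maximalIdeal_height_eq_ringKrullDim] at hdim
    exact WithBot.coe_le_coe.mp hdim
  obtain ⟨a, ha, ha0⟩ : ∃ a ∈ IsLocalRing.maximalIdeal R, a ≠ 0 := by
    apply Submodule.exists_mem_ne_zero_of_ne_bot
    intro h0
    rw [h0, Ideal.height_bot] at hm
    exact absurd hm (by simp)
  obtain ⟨b, hb, hbP⟩ : ∃ b ∈ IsLocalRing.maximalIdeal R,
      ∀ P ∈ (Ideal.span {a}).minimalPrimes, b ∉ P := by
    by_contra! hcon
    obtain ⟨P, hP, hmP⟩ := (Ideal.subset_union_prime_finite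
      (Ideal.finite_minimalPrimes_of_isNoetherianRing R (Ideal.span {a})) (f := id) ⊤ ⊤
      (fun P hP _ _ => hP.1.1)).mp (fun b hb => by simpa using hcon b hb)
    have h1 := Ideal.height_le_one_of_isPrincipal_of_mem_minimalPrimes _ P hP
    exact absurd ((hm.trans (Ideal.height_mono hmP)).trans h1) (by decide)
  have key : ∀ p : Ideal R, p.IsPrime → p.height ≤ 1 → a ∈ p → b ∉ p := by
    intro p hp hht hap
    obtain ⟨P, hP, hPp⟩ := Ideal.exists_minimalPrimes_le
      ((Ideal.span_singleton_le_iff_mem _).mpr hap)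
    have := hP.1.1
    have hP0 : P.height ≠ 0 := by
      rw [Ne, Ideal.height_eq_zero_iff_eq_bot]
      rintro rfl
      exact ha0 (by simpa using hP.1.2)
    have hfin : P.FiniteHeight := inferInstance
    have : P = p := Ideal.eq_of_le_of_height_le P hPp (hht.trans (Order.one_le_iff_ne_zero.mpr hP0))
    exact this ▸ hbP P hP
  refine ⟨a, b, ha, hb, ?_, key⟩
  rintro rfl
  obtain ⟨P, hP⟩ := Ideal.nonempty_minimalPrimes (I := Ideal.span {a})
    (fun h => (IsLocalRing.mem_maximalIdeal a).mp ha (Ideal.span_singleton_eq_top.mp h))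
  exact hbP P hP P.zero_mem

/-- The members `a - cₙ b` of a pencil, for constants `cₙ` of a nonzero derivation. -/
theorem exists_reduced_sequence_of_derivation {R : Type*} [CommRing R] [IsDomain R]
    [IsLocalRing R] [IsNoetherianRing R] [IsIntegrallyClosed R] (hdim : 2 ≤ ringKrullDim R)
    (D : Derivation ℤ R R) (hD : D ≠ 0)
    (hc : ∀ b ∈ IsLocalRing.maximalIdeal R, ∃ c : ℕ → R, (∀ n, D (c n) = 0) ∧
      ∀ p : Ideal R, p.IsPrime → ∀ m n, m ≠ n → c m - c n ∈ p → b ∈ p)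
    {ι : Type*} [Finite ι] (q : ι → Ideal R) (hprime : ∀ i, (q i).IsPrime)
    (hheight : ∀ i, (q i).height ≤ 1) :
    ∃ x : ℕ → R, Function.Injective (fun n => Ideal.span ({x n} : Set R)) ∧
      ∀ n, x n ≠ 0 ∧ (∀ i, x n ∉ q i) ∧ IsReduced (R ⧸ Ideal.span ({x n} : Set R)) := by
  obtain ⟨a, b, ha, hb, hb0, hab, hw⟩ : ∃ a b : R, a ∈ IsLocalRing.maximalIdeal R ∧
      b ∈ IsLocalRing.maximalIdeal R ∧ b ≠ 0 ∧
      (∀ p : Ideal R, p.IsPrime → p.height ≤ 1 → a ∈ p → b ∉ p) ∧ b * D a - a * D b ≠ 0 := by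
    obtain ⟨a, b, ha, hb, hb0, hab⟩ := exists_pair_notMem_prime hdim
    obtain ⟨e, he⟩ : ∃ e, D e ≠ 0 := by
      by_contra! h
      exact hD (Derivation.ext h)
    -- Replacing `a` by `a + b * e` keeps the common primes of `a` and `b` and adds `b * b * D e` to
    -- the Wronskian.
    by_cases hw : b * D a - a * D b = 0
    · refine ⟨a + b * e, b, Ideal.add_mem _ ha (Ideal.mul_mem_right _ _ hb), hb, hb0, ?_, ?_⟩
      · intro p hp hht hap hbp
        exact hab p hp hht ((p.add_mem_iff_left (p.mul_mem_right _ hbp)).mp hap) hbp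
      · have : b * D (a + b * e) - (a + b * e) * D b = b * b * D e := by
          simp only [map_add, Derivation.leibniz, smul_eq_mul]
          linear_combination hw
        rw [this]
        exact mul_ne_zero (mul_ne_zero hb0 hb0) he
    · exact ⟨a, b, ha, hb, hb0, hab, hw⟩
  obtain ⟨c, hDc, hcp⟩ := hc b hb
  let f : ℕ → R := fun n => a - c n * b
  have hfm : ∀ n, f n ∈ IsLocalRing.maximalIdeal R := fun n =>
    Ideal.sub_mem _ ha (Ideal.mul_mem_left _ _ hb)
  have hfp : ∀ p : Ideal R, p.IsPrime → p.height ≤ 1 → ∀ m n, f m ∈ p → f n ∈ p → m = n := by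
    intro p hp hht m n hm hn
    by_contra hmn
    have h1 : (c m - c n) * b ∈ p := by
      have := p.sub_mem hn hm
      have e : f n - f m = (c m - c n) * b := by simp only [f]; ring
      rwa [e] at this
    have h2 : b ∈ p := (hp.mem_or_mem h1).elim (hcp p hp m n hmn) id
    refine hab p hp hht ?_ h2
    have := p.add_mem hm (p.mul_mem_left (c m) h2)
    simpa [f] using this
  have hmin : ∀ y ∈ IsLocalRing.maximalIdeal R, ∃ p : Ideal R, p.IsPrime ∧ p.height ≤ 1 ∧ y ∈ p := by
    intro y hy
    obtain ⟨P, hP⟩ := Ideal.nonempty_minimalPrimes (I := Ideal.span {y})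
      (fun h => (IsLocalRing.mem_maximalIdeal y).mp hy (Ideal.span_singleton_eq_top.mp h))
    exact ⟨P, hP.1.1, Ideal.height_le_one_of_isPrincipal_of_mem_minimalPrimes _ P hP,
      (Ideal.span_singleton_le_iff_mem _).mp hP.1.2⟩
  have hf0 : ∀ n, f n ≠ 0 := by
    intro n h0
    obtain ⟨p, hp, hht, hbp⟩ := hmin b hb
    refine hab p hp hht ?_ hbp
    have : a = c n * b := sub_eq_zero.mp h0
    exact this ▸ p.mul_mem_left _ hbp
  -- The primes to avoid: those that can witness non-reducedness, and the given ones.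
  let S : Set (Ideal R) :=
    (Ideal.span {b * D a - a * D b}).minimalPrimes ∪ Set.range q
  have hSfin : S.Finite := (Ideal.finite_minimalPrimes_of_isNoetherianRing R _).union
    (Set.finite_range q)
  have hS : ∀ P ∈ S, P.IsPrime ∧ P.height ≤ 1 := by
    rintro P (hP | ⟨i, rfl⟩)
    · exact ⟨hP.1.1, Ideal.height_le_one_of_isPrincipal_of_mem_minimalPrimes _ P hP⟩
    · exact ⟨hprime i, hheight i⟩
  have hbad : {n | ∃ P ∈ S, f n ∈ P}.Finite := by
    have : {n | ∃ P ∈ S, f n ∈ P} = ⋃ P ∈ S, {n | f n ∈ P} := by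
      ext n; simp
    rw [this]
    exact hSfin.biUnion fun P hP => Set.Subsingleton.finite fun m hm n hn =>
      hfp P (hS P hP).1 (hS P hP).2 m n hm hn
  have hgood : {n | ∃ P ∈ S, f n ∈ P}ᶜ.Infinite := hbad.infinite_compl
  let g : ℕ → ℕ := fun n => hgood.natEmbedding _ n
  have hginj : Function.Injective g := fun m n h =>
    (hgood.natEmbedding _).injective (Subtype.ext h)
  have hg : ∀ n, ∀ P ∈ S, f (g n) ∉ P := by
    intro n P hP hm
    exact (hgood.natEmbedding _ n).2 ⟨P, hP, hm⟩
  refine ⟨fun n => f (g n), ?_, fun n => ⟨hf0 _, fun i => hg n _ (Or.inr ⟨i, rfl⟩), ?_⟩⟩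
  · intro m n hmn
    obtain ⟨p, hp, hht, hmp⟩ := hmin (f (g m)) (hfm _)
    refine hginj (hfp p hp hht _ _ hmp ?_)
    have h1 : f (g n) ∈ Ideal.span {f (g m)} := by
      have : Ideal.span {f (g m)} = Ideal.span {f (g n)} := hmn
      rw [this]
      exact Ideal.mem_span_singleton_self _
    exact (Ideal.span_singleton_le_iff_mem _).mpr hmp h1
  · by_contra hred
    obtain ⟨p, hp, hht, hfp', hDf⟩ :=
      exists_prime_derivation_mem_of_not_isReduced (hf0 (g n)) hred D
    have hwp : b * D a - a * D b ∈ p := by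
      have e : b * D a - a * D b = b * D (f (g n)) - f (g n) * D b := by
        simp only [f, map_sub, Derivation.leibniz, smul_eq_mul, hDc]
        ring
      rw [e]
      exact p.sub_mem (p.mul_mem_left _ hDf) (p.mul_mem_right _ hfp')
    obtain ⟨P, hP, hPp⟩ := Ideal.exists_minimalPrimes_le
      ((Ideal.span_singleton_le_iff_mem _).mpr hwp)
    have := hP.1.1
    have hP0 : P.height ≠ 0 := by
      rw [Ne, Ideal.height_eq_zero_iff_eq_bot]
      rintro rfl
      exact hw (by simpa using hP.1.2)
    have : P = p := Ideal.eq_of_le_of_height_le P hPp (hht.trans (Order.one_le_iff_ne_zero.mpr hP0))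
    exact hg n P (Or.inl hP) (this ▸ hfp')

/-! ### Lifting residue fields: existence of coefficient fields -/

/-- A subring of `A × B` that is the graph of a partial function defines a ring homomorphism. -/
theorem Subring.exists_ringHom_of_graph {A B : Type*} [Ring A] [Ring B] (G : Subring (A × B))
    (hG : ∀ z ∈ G, z.1 = 0 → z.2 = 0) (E : Subring A) (hE : ∀ a ∈ E, ∃ b, (a, b) ∈ G) :
    ∃ ψ : E →+* B, ∀ a : E, ((a : A), ψ a) ∈ G := by
  have huniq : ∀ a b c, (a, b) ∈ G → (a, c) ∈ G → b = c := fun a b c hb hc =>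
    sub_eq_zero.mp (hG _ (G.sub_mem hb hc) (sub_self a))
  choose ψ hψ using fun a : E => hE a a.2
  refine ⟨⟨⟨⟨ψ, ?_⟩, fun x y => ?_⟩, ?_, fun x y => ?_⟩, hψ⟩
  · exact huniq _ _ _ (hψ 1) G.one_mem
  · exact huniq _ _ _ (hψ (x * y)) (G.mul_mem (hψ x) (hψ y))
  · exact huniq _ _ _ (hψ 0) G.zero_mem
  · exact huniq _ _ _ (hψ (x + y)) (G.add_mem (hψ x) (hψ y))

/-- Modulo an ideal of square zero, `p`-th powers of lifts do not depend on the lifts. -/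
theorem exists_frobenius_lift {k B : Type*} [Field k] [CommRing B] (p : ℕ) [hp : Fact p.Prime] [CharP B p]
    (I : Ideal B) (hI : I ^ 2 = ⊥) (g : k →+* B ⧸ I) :
    ∃ φ : k →+* B, ∀ a b, Ideal.Quotient.mk I b = g a → b ^ p = φ a := by
  have hpow : ∀ x y : B, Ideal.Quotient.mk I x = Ideal.Quotient.mk I y → x ^ p = y ^ p := by
    intro x y h
    have h1 : (x - y) ^ 2 ∈ I ^ 2 := Ideal.pow_mem_pow (Ideal.Quotient.eq.mp h) 2
    rw [hI, Ideal.mem_bot] at h1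
    rw [← sub_eq_zero, ← sub_pow_char]
    exact pow_eq_zero_of_le hp.out.two_le h1
  choose s hs using fun a => Ideal.Quotient.mk_surjective (I := I) (g a)
  refine ⟨⟨⟨⟨fun a => s a ^ p, ?_⟩, fun a b => ?_⟩, ?_, fun a b => ?_⟩, fun a b h => ?_⟩
  · rw [hpow (s 1) 1 (by simp [hs]), one_pow]
  · simp only
    rw [hpow (s (a * b)) (s a * s b) (by simp [hs]), mul_pow]
  · simp only
    rw [hpow (s 0) 0 (by simp [hs]), zero_pow hp.out.ne_zero]
  · simp only
    rw [hpow (s (a + b)) (s a + s b) (by simp [hs]), add_pow_char]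
  · exact hpow _ _ (h.trans (hs a).symm)

/-- Ring homomorphisms from a field of characteristic `p` lift along ideals of square zero. -/
theorem exists_lift_of_sq_eq_bot_of_charP {k B : Type*} [Field k] [CommRing B] (p : ℕ) [hp : Fact p.Prime] [CharP k p] [CharP B p]
    (I : Ideal B) (hI : I ^ 2 = ⊥) (g : k →+* B ⧸ I) :
    ∃ σ : k →+* B, (Ideal.Quotient.mk I).comp σ = g := by
  obtain ⟨φ, hφ⟩ := exists_frobenius_lift p I hI g
  -- Zorn's lemma is applied to graphs of partial lifts of `g` that extend the canonical lift `φ` on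
  -- the subfield of `p`-th powers.
  let S : Set (Subring (k × B)) := {G | ((frobenius k p).prod φ).range ≤ G ∧
    (∀ z ∈ G, Ideal.Quotient.mk I z.2 = g z.1) ∧ ∀ z ∈ G, z.1 = 0 → z.2 = 0}
  have h0 : ((frobenius k p).prod φ).range ∈ S := by
    refine ⟨le_rfl, ?_, ?_⟩
    · rintro _ ⟨a, rfl⟩
      obtain ⟨b, hb⟩ := Ideal.Quotient.mk_surjective (I := I) (g a)
      simp [← hφ a b hb, hb, frobenius_def]
    · rintro _ ⟨a, rfl⟩ h
      have : a = 0 := by simpa [frobenius_def, hp.out.ne_zero] using h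
      simp [this]
  obtain ⟨G, -, hGmax⟩ := zorn_le_nonempty₀ S (fun c hcS hc y hy => by
    have hmem : ∀ z, z ∈ sSup c ↔ ∃ s ∈ c, z ∈ s := fun z =>
      Subring.mem_sSup_of_directedOn ⟨y, hy⟩ hc.directedOn
    refine ⟨sSup c, ⟨(hcS hy).1.trans (le_sSup hy), fun z hz => ?_, fun z hz => ?_⟩,
      fun z hz => le_sSup hz⟩
    · obtain ⟨s, hs, hzs⟩ := (hmem z).mp hz
      exact (hcS hs).2.1 z hzs
    · obtain ⟨s, hs, hzs⟩ := (hmem z).mp hz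
      exact (hcS hs).2.2 z hzs) _ h0
  obtain ⟨hGφ, hGg, hGinj⟩ := hGmax.prop
  have hGp : ∀ a, (a ^ p, φ a) ∈ G := fun a => hGφ ⟨a, rfl⟩
  -- The domain of the maximal lift contains all `p`-th powers, so it is closed under inverses: `x⁻¹
  -- = x ^ (p - 1) * (x⁻¹) ^ p`.
  let E : Subfield k :=
    { G.map (RingHom.fst k B) with
      inv_mem' := by
        rintro _ ⟨⟨x, y⟩, hxy, rfl⟩
        refine ⟨(x, y) ^ (p - 1) * (x⁻¹ ^ p, φ x⁻¹), G.mul_mem (G.pow_mem hxy _) (hGp _), ?_⟩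
        rcases eq_or_ne x 0 with rfl | hx
        · simp [hp.out.ne_zero]
        · simp only [RingHom.coe_fst, Prod.fst_mul, Prod.pow_fst]
          rw [inv_pow, ← div_eq_mul_inv, div_eq_iff (pow_ne_zero _ hx), eq_inv_mul_iff_mul_eq₀ hx,
            mul_pow_sub_one hp.out.ne_zero] }
  have hE : ∀ a ∈ E, ∃ b, (a, b) ∈ G := by
    rintro _ ⟨⟨x, y⟩, hxy, rfl⟩
    exact ⟨y, hxy⟩
  obtain ⟨ψ, hψ⟩ := G.exists_ringHom_of_graph hGinj E.toSubring hE
  have huniq : ∀ a b c, (a, b) ∈ G → (a, c) ∈ G → b = c := fun a b c hb hc =>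
    sub_eq_zero.mp (hGinj _ (G.sub_mem hb hc) (sub_self a))
  have htop : ∀ a, a ∈ E := by
    intro a
    by_contra ha
    obtain ⟨b, hb⟩ := Ideal.Quotient.mk_surjective (I := I) (g a)
    let ψ' : E →+* B := ψ
    -- The lift is extended by `a ↦ b`. This is well defined because `a` has minimal polynomial `X ^
    -- p - a ^ p` over `E`, and every lift `b` of `g a` satisfies `b ^ p = φ a`.
    let Θ : Polynomial E →+* k × B :=
      (Polynomial.eval₂RingHom E.subtype a).prod (Polynomial.eval₂RingHom ψ' b)
    have hle : G ≤ Θ.range := by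
      rintro ⟨x, y⟩ hxy
      have hx : x ∈ E := ⟨(x, y), hxy, rfl⟩
      refine ⟨Polynomial.C ⟨x, hx⟩, ?_⟩
      simp only [Θ, RingHom.prod_apply, Polynomial.coe_eval₂RingHom, Polynomial.eval₂_C]
      exact Prod.ext rfl (huniq x _ _ (hψ ⟨x, hx⟩) hxy)
    have hΘ : Θ.range ∈ S := by
      refine ⟨hGφ.trans hle, ?_, ?_⟩
      · rintro _ ⟨P, rfl⟩
        simp only [Θ, RingHom.prod_apply, Polynomial.coe_eval₂RingHom]
        rw [Polynomial.hom_eval₂, Polynomial.hom_eval₂, hb]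
        congr 1
        ext x
        exact hGg _ (hψ x)
      · rintro _ ⟨P, rfl⟩ hP
        simp only [Θ, RingHom.prod_apply, Polynomial.coe_eval₂RingHom] at hP ⊢
        have hap : a ^ p ∈ E := ⟨_, hGp a, rfl⟩
        have hirr : Irreducible (Polynomial.X ^ p - Polynomial.C (⟨a ^ p, hap⟩ : E)) := by
          refine X_pow_sub_C_irreducible_of_prime hp.out fun c hc => ha ?_
          have h1 : (c : k) ^ p = a ^ p := congrArg Subtype.val hc
          have h2 : (c : k) = a := frobenius_inj k p h1
          exact h2 ▸ c.2
        have hmin : Polynomial.X ^ p - Polynomial.C (⟨a ^ p, hap⟩ : E) = minpoly E a := by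
          refine minpoly.eq_of_irreducible_of_monic hirr ?_
            (Polynomial.monic_X_pow_sub_C _ hp.out.ne_zero)
          simp only [map_sub, map_pow, Polynomial.aeval_X, Polynomial.aeval_C]
          exact sub_self _
        obtain ⟨Q, rfl⟩ : Polynomial.X ^ p - Polynomial.C (⟨a ^ p, hap⟩ : E) ∣ P :=
          hmin ▸ minpoly.dvd E a hP
        rw [Polynomial.eval₂_mul, Polynomial.eval₂_sub, Polynomial.eval₂_pow, Polynomial.eval₂_X,
          Polynomial.eval₂_C, hφ a b hb, huniq _ _ _ (hψ ⟨a ^ p, hap⟩) (hGp a), sub_self, zero_mul]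
    have hab : (a, b) ∈ G := hGmax.le_of_ge hΘ hle ⟨Polynomial.X, by simp [Θ]⟩
    exact ha ⟨_, hab, rfl⟩
  obtain ⟨σ, hσ⟩ := G.exists_ringHom_of_graph hGinj ⊤ fun a _ => hE a (htop a)
  refine ⟨σ.comp (Subring.topEquiv (R := k)).symm.toRingHom, ?_⟩
  ext a
  exact hGg _ (hσ ⟨a, trivial⟩)

/-- Every field of prime characteristic is formally smooth over its prime field. -/
theorem formallySmooth_zmod (p : ℕ) [hp : Fact p.Prime] (k : Type*) [Field k] [Algebra (ZMod p) k] :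
    Algebra.FormallySmooth (ZMod p) k := by
  refine Algebra.FormallySmooth.of_comp_surjective fun B _ _ I hI g => ?_
  rcases subsingleton_or_nontrivial B with hB | hB
  · have : Subsingleton (B ⧸ I) := Ideal.Quotient.mk_surjective.subsingleton
    exact ⟨default, Subsingleton.elim _ _⟩
  · have : CharP k p := charP_of_injective_algebraMap (algebraMap (ZMod p) k).injective p
    have : CharP B p := charP_of_injective_algebraMap (algebraMap (ZMod p) B).injective p
    obtain ⟨σ, hσ⟩ := exists_lift_of_sq_eq_bot_of_charP p I hI g.toRingHom
    refine ⟨⟨σ, fun r => RingHom.congr_fun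
      (RingHom.ext_zmod (σ.comp (algebraMap _ _)) (algebraMap _ _)) r⟩, ?_⟩
    ext a
    exact RingHom.congr_fun hσ a

/-- Every field of characteristic zero is formally smooth over the rationals. -/
theorem formallySmooth_rat (k : Type*) [Field k] [Algebra ℚ k] : Algebra.FormallySmooth ℚ k := by
  have : CharZero k := charZero_of_injective_algebraMap (algebraMap ℚ k).injective
  -- In characteristic zero, `k` is separable algebraic over the field generated by a transcendence
  -- basis.
  obtain ⟨s, hs⟩ := exists_isTranscendenceBasis ℚ k
  have := hs.isAlgebraic_field
  exact .of_algebraicIndependent_of_isSeparable hs.1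

open IsLocalRing in
/-- A complete local ring of equal characteristic has a coefficient field. -/
theorem exists_coefficientField {R : Type*} [CommRing R] [IsLocalRing R]
    [IsAdicComplete (maximalIdeal R) R] (hchar : ringChar R = ringChar (ResidueField R)) :
    ∃ σ : ResidueField R →+* R, ∀ a, residue R (σ a) = a := by
  rcases CharP.char_is_prime_or_zero (ResidueField R) (ringChar (ResidueField R)) with hp | h0
  · set p := ringChar (ResidueField R) with hpdef
    have : Fact p.Prime := ⟨hp⟩
    have : CharP R p := ringChar.of_eq hchar
    let _ : Algebra (ZMod p) R := ZMod.algebra R p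
    have := formallySmooth_zmod p (ResidueField R)
    obtain ⟨g, hg⟩ := Algebra.FormallySmooth.exists_mkₐ_comp_eq_of_isAdicComplete
      (I := maximalIdeal R) (AlgHom.id (ZMod p) (ResidueField R))
    exact ⟨g.toRingHom, fun a => AlgHom.congr_fun hg a⟩
  · have : CharP (ResidueField R) 0 := ringChar.of_eq h0
    have : CharZero (ResidueField R) := CharP.charP_to_charZero _
    -- Every proper quotient of `R` maps to the residue field, so it has characteristic zero.
    obtain ⟨_⟩ := (EqualCharZero.nonempty_algebraRat_iff R).mpr fun I hI => by
      let π : R ⧸ I →+* ResidueField R := Ideal.Quotient.factor (le_maximalIdeal hI)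
      exact π.charZero
    let A : Algebra ℚ (ResidueField R) := inferInstanceAs (Algebra ℚ (R ⧸ maximalIdeal R))
    have : Algebra.FormallySmooth ℚ (R ⧸ maximalIdeal R) := @formallySmooth_rat (ResidueField R) _ A
    obtain ⟨g, hg⟩ := Algebra.FormallySmooth.exists_mkₐ_comp_eq_of_isAdicComplete
      (I := maximalIdeal R) (AlgHom.id ℚ (R ⧸ maximalIdeal R))
    exact ⟨g.toRingHom, fun a => AlgHom.congr_fun hg a⟩

/-! ### Finiteness over a power series ring -/

/-- Evaluation of power series at topologically nilpotent elements of a complete ring. -/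
theorem MvPowerSeries.exists_ringHom_of_isAdicComplete {ι k R : Type*} [Finite ι] [CommRing k]
    [CommRing R] (m : Ideal R) [IsAdicComplete m R] (σ : k →+* R) (x : ι → R)
    (hx : ∀ i, x i ∈ m) :
    ∃ Φ : MvPowerSeries ι k →+* R,
      (∀ a, Φ (MvPowerSeries.C a) = σ a) ∧ ∀ i, Φ (MvPowerSeries.X i) = x i := by
  let θ : MvPolynomial ι k →+* R := MvPolynomial.eval₂Hom σ x
  let I := MvPolynomial.idealOfVars ι k
  have hI : I ≤ m.comap θ := by
    refine Ideal.span_le.mpr ?_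
    rintro _ ⟨i, rfl⟩
    simpa [θ] using hx i
  have hIn : ∀ n, I ^ n ≤ (m ^ n).comap θ := fun n =>
    (Ideal.pow_right_mono hI n).trans (Ideal.le_comap_pow θ n)
  -- Modulo `m ^ n`, substitution depends only on the truncation below total degree `n`; these maps
  -- are compatible and glue by completeness.
  let f : ∀ n, MvPowerSeries ι k →+* R ⧸ m ^ n := fun n =>
    (Ideal.quotientMap (m ^ n) θ (hIn n)).comp
      (MvPowerSeries.truncTotalAlgHom ι k n : _ →+* MvPolynomial ι k ⧸ I ^ n)
  have hf : ∀ {a b : ℕ} (hle : a ≤ b), (Ideal.Quotient.factorPow m hle).comp (f b) = f a := by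
    intro a b hle
    ext z
    have h1 : Ideal.Quotient.mk (I ^ a) (truncTotal b z) =
        Ideal.Quotient.mk (I ^ a) (truncTotal a z) :=
      Ideal.Quotient.eq.mpr (truncTotal_sub_truncTotal_mem_pow_idealOfVars hle le_rfl _)
    exact congrArg (Ideal.quotientMap (m ^ a) θ (hIn a)) h1
  have hval : ∀ P : MvPolynomial ι k,
      IsAdicComplete.liftRingHom m f hf (P : MvPowerSeries ι k) = θ P := by
    intro P
    rw [← sub_eq_zero]
    refine IsHausdorff.haus' (I := m) _ fun n => ?_
    rw [SModEq.zero, smul_eq_mul, Ideal.mul_top, ← Ideal.Quotient.eq_zero_iff_mem, map_sub,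
      IsAdicComplete.mk_liftRingHom]
    have h1 : MvPowerSeries.truncTotalAlgHom ι k n (P : MvPowerSeries ι k) =
        Ideal.Quotient.mk (I ^ n) P := (MvPowerSeries.truncTotalAlgHom ι k n).commutes P
    simp only [f, RingHom.comp_apply, RingHom.coe_coe, h1, Ideal.quotientMap_mk, sub_self]
  refine ⟨IsAdicComplete.liftRingHom m f hf, fun a => ?_, fun i => ?_⟩
  · rw [← MvPolynomial.coe_C, hval]
    simp [θ]
  · rw [← MvPolynomial.coe_X, hval]
    simp [θ]

theorem Ideal.mem_smul_top_pi_iff {A ι : Type*} [CommRing A] [Fintype ι] (I : Ideal A)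
    (v : ι → A) : v ∈ (I • ⊤ : Submodule A (ι → A)) ↔ ∀ i, v i ∈ I := by
  classical
  constructor
  · intro h i
    refine Submodule.smul_induction_on h (fun r hr w _ => ?_) fun x y hx hy => I.add_mem hx hy
    exact I.mul_mem_right _ hr
  · intro h
    have : v = ∑ i, v i • Pi.single i (1 : A) := pi_eq_sum_univ' v
    rw [this]
    exact Submodule.sum_mem _ fun i _ => Submodule.smul_mem_smul (h i) trivial

theorem IsPrecomplete.pi_self {A ι : Type*} [CommRing A] [Fintype ι] (I : Ideal A)
    [IsPrecomplete I A] : IsPrecomplete I (ι → A) := by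
  refine ⟨fun f hf => ?_⟩
  have key : ∀ i, ∃ L : A, ∀ n, f n i ≡ L [SMOD I ^ n • (⊤ : Submodule A A)] := fun i =>
    IsPrecomplete.prec' (I := I) (fun n => f n i) fun {m n} hmn => by
      have := hf hmn
      rw [SModEq.sub_mem, Ideal.mem_smul_top_pi_iff] at this
      rw [SModEq.sub_mem, smul_eq_mul, Ideal.mul_top]
      exact this i
  choose L hL using key
  refine ⟨L, fun n => ?_⟩
  rw [SModEq.sub_mem, Ideal.mem_smul_top_pi_iff]
  intro i
  have := hL i n
  rwa [SModEq.sub_mem, smul_eq_mul, Ideal.mul_top] at this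

/-- A separated module over a complete ring is finite if it is finite modulo the ideal. -/
theorem Module.Finite.of_span_sup_smul_top {A M : Type*} [CommRing A] (I : Ideal A)
    [IsPrecomplete I A] [AddCommGroup M] [Module A M] [IsHausdorff I M] (s : Finset M)
    (hs : Submodule.span A (s : Set M) ⊔ I • ⊤ = ⊤) : Module.Finite A M := by
  have := IsPrecomplete.pi_self (ι := s) I
  let f : (s → A) →ₗ[A] M := Fintype.linearCombination A (fun i : s => (i : M))
  refine Module.Finite.of_surjective f (surjective_of_mkQ_comp_surjective (I := I) ?_)
  rw [← LinearMap.range_eq_top, LinearMap.range_comp, Fintype.range_linearCombination]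
  rw [Submodule.map_mkQ_eq_top, sup_comm]
  simpa using hs

/-- The power series ring is the adic completion of the polynomial ring at the finitely generated
ideal of the variables. There, the kernel of reduction modulo that ideal is its extension. -/
theorem MvPowerSeries.mem_span_range_X {ι k : Type*} [Finite ι] [CommRing k]
    {f : MvPowerSeries ι k} (hf : MvPowerSeries.constantCoeff f = 0) :
    f ∈ Ideal.span (Set.range (MvPowerSeries.X : ι → MvPowerSeries ι k)) := by
  let I := MvPolynomial.idealOfVars ι k
  let e := MvPowerSeries.toAdicCompletionAlgEquiv ι k
  have h1 : e f ∈ (I ^ 1 • ⊤ : Submodule (MvPolynomial ι k) (AdicCompletion I _)) := by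
    rw [AdicCompletion.pow_smul_top_eq_ker_eval (MvPolynomial.idealOfVars_fg ι k),
      LinearMap.mem_ker]
    have h2 : MvPowerSeries.truncTotal 1 f ∈ I ^ 1 := by
      refine (MvPolynomial.mem_pow_idealOfVars_iff' ..).mpr fun x hx => ?_
      rw [MvPowerSeries.coeff_truncTotal _ hx]
      have : x = 0 := (Finsupp.degree_eq_zero_iff x).mp (Nat.lt_one_iff.mp hx)
      simpa [this] using hf
    have h3 : (I ^ 1 • ⊤ : Ideal (MvPolynomial ι k)) = I ^ 1 := by
      rw [smul_eq_mul, Ideal.mul_top]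
    change Ideal.Quotient.mk (I ^ 1 • ⊤ : Ideal (MvPolynomial ι k)) (truncTotal 1 f) = 0
    rwa [Ideal.Quotient.eq_zero_iff_mem, h3]
  have h3 : ∀ w ∈ (I ^ 1 • ⊤ : Submodule (MvPolynomial ι k) (AdicCompletion I _)),
      e.symm w ∈ Ideal.span (Set.range (MvPowerSeries.X : ι → MvPowerSeries ι k)) := by
    intro w hw
    refine Submodule.smul_induction_on hw (fun r hr w _ => ?_) fun x y hx hy => ?_
    · rw [map_smul, Algebra.smul_def]
      refine Ideal.mul_mem_right _ _ ?_
      rw [pow_one] at hr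
      have : I ≤ (Ideal.span (Set.range (MvPowerSeries.X : ι → MvPowerSeries ι k))).comap
          (algebraMap _ _) := by
        refine Ideal.span_le.mpr ?_
        rintro _ ⟨i, rfl⟩
        refine Ideal.subset_span ⟨i, ?_⟩
        exact (MvPolynomial.coe_X i).symm
      exact this hr
    · rw [map_add]
      exact Ideal.add_mem _ hx hy
  simpa using h3 _ h1

theorem MvPowerSeries.ringKrullDim_le {ι k : Type*} [Fintype ι] [Field k] :
    ringKrullDim (MvPowerSeries ι k) ≤ Fintype.card ι := by
  have h : IsLocalRing.maximalIdeal (MvPowerSeries ι k) =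
      Ideal.span (Set.range (MvPowerSeries.X : ι → MvPowerSeries ι k)) := by
    apply le_antisymm
    · intro f hf
      refine MvPowerSeries.mem_span_range_X (by_contra fun h0 => ?_)
      exact (IsLocalRing.mem_maximalIdeal f).mp hf
        (MvPowerSeries.isUnit_iff_constantCoeff.mpr (isUnit_iff_ne_zero.mpr h0))
    · refine Ideal.span_le.mpr ?_
      rintro _ ⟨i, rfl⟩
      refine (IsLocalRing.mem_maximalIdeal _).mpr fun hu => ?_
      simpa using MvPowerSeries.isUnit_iff_constantCoeff.mp hu
  refine (ringKrullDim_le_spanFinrank_maximalIdeal _).trans ?_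
  rw [h]
  have h1 := Submodule.spanFinrank_span_le_ncard_of_finite (R := MvPowerSeries ι k)
    (Set.finite_range (MvPowerSeries.X : ι → MvPowerSeries ι k))
  have h2 : (Set.range (MvPowerSeries.X : ι → MvPowerSeries ι k)).ncard ≤ Fintype.card ι := by
    rw [← Set.image_univ]
    exact (Set.ncard_image_le Set.finite_univ).trans (by simp [Set.ncard_univ])
  exact_mod_cast h1.trans h2

/-- By incomparability, contraction of primes along an integral map is strictly monotone. -/
theorem ringKrullDim_le_of_isIntegral (A R : Type*) [CommRing A] [CommRing R] [Algebra A R]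
    [Algebra.IsIntegral A R] : ringKrullDim R ≤ ringKrullDim A :=
  Order.krullDim_le_of_strictMono (PrimeSpectrum.comap (algebraMap A R)) fun _ _ h =>
    Ideal.IsIntegral.comap_lt_comap h

/-- An integral homomorphism from a domain to a ring of at least the same finite dimension is
injective. -/
theorem injective_algebraMap_of_ringKrullDim_le (A R : Type*) [CommRing A] [IsDomain A]
    [CommRing R] [Algebra A R] [Algebra.IsIntegral A R] {n : ℕ} (hA : ringKrullDim A ≤ n)
    (hR : n ≤ ringKrullDim R) : Function.Injective (algebraMap A R) := by
  rw [injective_iff_map_eq_zero]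
  intro f hf
  by_contra hf0
  -- A nonzero `f` in the kernel would make `R` integral over `A ⧸ (f)`, whose dimension is at most
  -- `n - 1`.
  let π : A ⧸ Ideal.span {f} →+* R := Ideal.Quotient.lift _ (algebraMap A R) fun a ha => by
    obtain ⟨b, rfl⟩ := Ideal.mem_span_singleton.mp ha
    rw [map_mul, hf, zero_mul]
  let _ : Algebra (A ⧸ Ideal.span {f}) R := π.toAlgebra
  have : IsScalarTower A (A ⧸ Ideal.span {f}) R := .of_algebraMap_eq fun _ => rfl
  have : Algebra.IsIntegral (A ⧸ Ideal.span {f}) R := .tower_top A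
  have h1 := ringKrullDim_le_of_isIntegral (A ⧸ Ideal.span {f}) R
  have h2 := ringKrullDim_quotient_succ_le_of_nonZeroDivisor (mem_nonZeroDivisors_of_ne_zero hf0)
  have h3 : (n : WithBot ℕ∞) + 1 ≤ n :=
    (add_le_add_left (hR.trans h1) 1).trans (h2.trans hA)
  have h4 : n + 1 ≤ n := by exact_mod_cast h3
  omega

open IsLocalRing in
/-- If an `A`-algebra structure on a Noetherian local ring `R` surjects onto the residue field, then
`R` is generated by finitely many elements over `A` modulo every power of the maximal ideal. -/
theorem IsLocalRing.exists_finset_span_sup_pow_eq_top (A R : Type*) [CommRing A] [CommRing R]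
    [IsLocalRing R] [IsNoetherianRing R] [Algebra A R]
    (h : ∀ r : R, ∃ a : A, r - algebraMap A R a ∈ maximalIdeal R) (n : ℕ) :
    ∃ T : Finset R,
      Submodule.span A (T : Set R) ⊔ (maximalIdeal R ^ n).restrictScalars A = ⊤ := by
  classical
  induction n with
  | zero => exact ⟨∅, by simp⟩
  | succ n ih =>
    obtain ⟨T, hT⟩ := ih
    obtain ⟨G, hG⟩ := IsNoetherian.noetherian (maximalIdeal R ^ n)
    refine ⟨T ∪ G, top_le_iff.mp (hT ▸ sup_le ?_ ?_)⟩
    · exact le_sup_of_le_left (Submodule.span_mono (by simp))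
    · intro z hz
      have hz' : z ∈ Submodule.span R (G : Set R) := hG ▸ hz
      induction hz' using Submodule.span_induction with
      | mem x hx => exact Submodule.mem_sup_left (Submodule.subset_span (by simp [hx]))
      | zero => exact zero_mem _
      | add x y hx hy hx' hy' =>
        rw [hG] at hx hy
        exact add_mem (hx' hx) (hy' hy)
      | smul r x hx hx' =>
        rw [hG] at hx
        obtain ⟨a, ha⟩ := h r
        have e : r • x = a • x + (r - algebraMap A R a) * x := by
          rw [smul_eq_mul, Algebra.smul_def]
          ring
        rw [e]
        refine add_mem (Submodule.smul_mem _ a (hx' hx)) (Submodule.mem_sup_right ?_)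
        change _ ∈ maximalIdeal R ^ (n + 1)
        rw [pow_succ']
        exact Ideal.mul_mem_mul ha hx

open IsLocalRing in
/-- A complete Noetherian local ring of equal characteristic is finite over a ring of formal power
series with as many variables as its dimension. -/
theorem exists_finite_injective_mvPowerSeries {R : Type*} [CommRing R] [IsLocalRing R]
    [IsNoetherianRing R] [IsAdicComplete (maximalIdeal R) R]
    (hchar : ringChar R = ringChar (ResidueField R)) :
    ∃ (s : Finset R) (Φ : MvPowerSeries s (ResidueField R) →+* R),
      Φ.Finite ∧ Function.Injective Φ ∧ s.card = ringKrullDim R := by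
  obtain ⟨σ, hσ⟩ := exists_coefficientField hchar
  -- `s` is a system of parameters: the maximal ideal is minimal over it and its size is the
  -- dimension.
  obtain ⟨s, hs, hcard⟩ :=
    Ideal.exists_finset_card_eq_height_of_isNoetherianRing (maximalIdeal R)
  have hdim : (s.card : WithBot ℕ∞) = ringKrullDim R := by
    rw [← maximalIdeal_height_eq_ringKrullDim, ← hcard]
    rfl
  have hsm : ∀ i : s, (i : R) ∈ maximalIdeal R := fun i => hs.1.2 (Ideal.subset_span i.2)
  obtain ⟨Φ, hΦC, hΦX⟩ := MvPowerSeries.exists_ringHom_of_isAdicComplete (maximalIdeal R) σ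
    (fun i : s => (i : R)) hsm
  let _ : Algebra (MvPowerSeries s (ResidueField R)) R := Φ.toAlgebra
  let I : Ideal (MvPowerSeries s (ResidueField R)) := Ideal.span (Set.range MvPowerSeries.X)
  have hImap : I.map (algebraMap _ R) = Ideal.span s := by
    rw [Ideal.map_span, ← Set.range_comp]
    congr 1
    ext y
    simp only [Set.mem_range, Function.comp_apply]
    exact ⟨fun ⟨i, hi⟩ => hi ▸ (hΦX i).symm ▸ i.2, fun hy => ⟨⟨y, hy⟩, hΦX _⟩⟩
  have hHaus : IsHausdorff I R := by
    refine ⟨fun y hy => IsHausdorff.haus' (I := maximalIdeal R) y fun n => ?_⟩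
    have h1 := hy n
    rw [SModEq.zero, Ideal.smul_top_eq_map, Ideal.map_pow, hImap] at h1
    rw [SModEq.zero, smul_eq_mul, Ideal.mul_top]
    exact Ideal.pow_right_mono hs.1.2 n h1
  have hfin : Module.Finite (MvPowerSeries s (ResidueField R)) R := by
    -- The maximal ideal is the only prime containing `s`, so some power of it lies in `(s) = I R`;
    -- thus `R` is finite modulo `I R`.
    have hrad : (Ideal.span (s : Set R)).radical = maximalIdeal R := by
      refine le_antisymm ((IsLocalRing.maximalIdeal.isMaximal R).isPrime.radical_le_iff.mpr hs.1.2) ?_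
      rw [Ideal.radical_eq_sInf]
      exact le_sInf fun J hJ => hs.2 ⟨hJ.2, hJ.1⟩ (le_maximalIdeal hJ.2.ne_top)
    obtain ⟨N, hN⟩ := (Ideal.span (s : Set R)).exists_radical_pow_le_of_fg
      (IsNoetherian.noetherian _)
    rw [hrad] at hN
    obtain ⟨T, hT⟩ := exists_finset_span_sup_pow_eq_top (MvPowerSeries s (ResidueField R)) R
      (fun r => ⟨MvPowerSeries.C (residue R r), by
        rw [← residue_eq_zero_iff, map_sub]
        change residue R r - residue R (Φ _) = 0
        rw [hΦC, hσ, sub_self]⟩) N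
    refine Module.Finite.of_span_sup_smul_top I T (top_le_iff.mp
      (hT.symm.le.trans (sup_le_sup_left ?_ _)))
    rw [Ideal.smul_top_eq_map, hImap]
    exact hN
  have : IsDomain (MvPowerSeries s (ResidueField R)) := NoZeroDivisors.to_isDomain _
  refine ⟨s, Φ, hfin, ?_, hdim⟩
  refine injective_algebraMap_of_ringKrullDim_le (MvPowerSeries s (ResidueField R)) R (n := s.card)
    ?_ hdim.le
  simpa using MvPowerSeries.ringKrullDim_le (ι := s) (k := ResidueField R)

/-! ### Extending derivations through finite extensions -/

open TensorProduct in
/-- Derivations extend along formally étale algebras. -/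
theorem Derivation.exists_extension_of_formallyEtale {A K : Type*} [CommRing A] [CommRing K]
    [Algebra A K] [Algebra.FormallyEtale A K] (d : Derivation ℤ A K) :
    ∃ D : Derivation ℤ K K, ∀ a, D (algebraMap A K a) = d a := by
  let ℓ : K ⊗[A] Ω[A⁄ℤ] →ₗ[K] K := d.liftKaehlerDifferential.liftBaseChange K
  let e := KaehlerDifferential.tensorKaehlerEquivOfFormallyEtale ℤ A K
  refine ⟨(ℓ ∘ₗ e.symm.toLinearMap).compDer (KaehlerDifferential.D ℤ K), fun a => ?_⟩
  have := KaehlerDifferential.tensorKaehlerEquivOfFormallyEtale_symm_D_algebraMap ℤ A K a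
  simp [ℓ, e, this]

/-- A finitely generated field extension that is not separable has a nonzero derivation. -/
theorem exists_derivation_ne_zero_of_not_isSeparable {L K : Type*} [Field L] [Field K]
    [Algebra L K] [Algebra.EssFiniteType L K] (h : ¬ Algebra.IsSeparable L K) :
    ∃ D : Derivation L K K, D ≠ 0 := by
  have h1 : Nontrivial (Ω[K⁄L]) := by
    rw [← not_subsingleton_iff_nontrivial]
    exact fun h2 => h ((Algebra.FormallyUnramified.iff_isSeparable L K).mp ⟨h2⟩)
  by_contra! hD
  have h2 : ∀ w : Ω[K⁄L], w = 0 := by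
    intro w
    rw [← Module.forall_dual_apply_eq_zero_iff K]
    intro ℓ
    have h3 : ℓ = 0 := (KaehlerDifferential.linearMapEquivDerivation L K).injective
      ((hD _).trans (map_zero _).symm)
    rw [h3, LinearMap.zero_apply]
  exact not_subsingleton (Ω[K⁄L]) ⟨fun x y => (h2 x).trans (h2 y).symm⟩

/-- Every nonzero derivation is a nonzero derivation over the integers. -/
theorem Derivation.exists_int_eq {L K : Type*} [CommRing L] [CommRing K] [Algebra L K]
    (D : Derivation L K K) (hD : D ≠ 0) :
    ∃ D' : Derivation ℤ K K, D' ≠ 0 ∧ ∀ x, D' x = D x :=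
  ⟨Derivation.mk' (D : K →+ K).toIntLinearMap D.leibniz,
    fun h => hD (Derivation.ext fun x => Derivation.congr_fun h x), fun _ => rfl⟩

/-- A derivation of the fraction field that maps a ring `A` into the domain `R`, finite over `A`, becomes,
after clearing denominators, a derivation of the domain. -/
theorem exists_derivation_ne_zero_of_fractionRing {A R K : Type*} [CommRing A] [CommRing R]
    [IsDomain R] [Field K] [Algebra A R] [Module.Finite A R] [Algebra R K] [IsFractionRing R K]
    (D : Derivation ℤ K K) (hD : D ≠ 0)
    (hA : ∀ a : A, D (algebraMap R K (algebraMap A R a)) ∈ (algebraMap R K).range) :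
    ∃ D' : Derivation ℤ R R, D' ≠ 0 := by
  classical
  have hinj : Function.Injective (algebraMap R K) := IsFractionRing.injective R K
  obtain ⟨T, hT⟩ := Module.Finite.fg_top (R := A) (M := R)
  -- `g` is a common denominator for `D` on the module generators. By Leibniz, `g * D` then maps all
  -- of `R` into `R`, since `D` already sends `A` into `R`.
  obtain ⟨g, hg⟩ := IsLocalization.exist_integer_multiples_of_finset (nonZeroDivisors R)
    (T.image fun t => D (algebraMap R K t))
  have hgD : ∀ r : R, ∃ r' : R, algebraMap R K r' = algebraMap R K g * D (algebraMap R K r) := by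
    intro r
    change _ ∈ (algebraMap R K).range
    have hr : r ∈ Submodule.span A (T : Set R) := hT ▸ trivial
    induction hr using Submodule.span_induction with
    | mem x hx =>
      obtain ⟨y, hy⟩ := hg _ (Finset.mem_image_of_mem _ hx)
      exact ⟨y, by rw [hy, Algebra.smul_def]⟩
    | zero => simp
    | add x y _ _ hx hy =>
      rw [map_add, map_add, mul_add]
      exact add_mem hx hy
    | smul a x _ hx =>
      have e : algebraMap R K g * D (algebraMap R K (a • x)) =
          algebraMap R K (algebraMap A R a) * (algebraMap R K g * D (algebraMap R K x)) +
            algebraMap R K (g * x) * D (algebraMap R K (algebraMap A R a)) := by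
        rw [Algebra.smul_def, map_mul, D.leibniz, smul_eq_mul, smul_eq_mul, map_mul]
        ring
      rw [e]
      exact add_mem (mul_mem ⟨_, rfl⟩ hx) (mul_mem ⟨_, rfl⟩ (hA a))
  choose F hF using hgD
  let F' : R →+ R :=
    { toFun := F
      map_zero' := hinj (by simp [hF])
      map_add' := fun x y => hinj (by simp [hF, mul_add]) }
  let D' : Derivation ℤ R R := Derivation.mk' F'.toIntLinearMap fun x y => hinj (by
    simp only [F', AddMonoidHom.coe_toIntLinearMap, AddMonoidHom.coe_mk, ZeroHom.coe_mk, hF,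
      smul_eq_mul, map_mul, map_add, Derivation.leibniz]
    ring)
  refine ⟨D', fun h0 => hD (Derivation.ext fun z => ?_)⟩
  have hg0 : algebraMap R K g ≠ 0 := by
    simp
  have hDR : ∀ r : R, D (algebraMap R K r) = 0 := by
    intro r
    have h1 : F r = 0 := Derivation.congr_fun h0 r
    have h2 := hF r
    rw [h1, map_zero] at h2
    exact (mul_eq_zero.mp h2.symm).resolve_left hg0
  obtain ⟨x, y, hy, rfl⟩ := IsFractionRing.div_surjective (A := R) z
  have hy0 : algebraMap R K y ≠ 0 := by
    simpa using nonZeroDivisors.ne_zero hy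
  have h1 : algebraMap R K y * (algebraMap R K x / algebraMap R K y) = algebraMap R K x :=
    mul_div_cancel₀ _ hy0
  have h2 := congrArg D h1
  rw [D.leibniz, hDR, hDR, smul_zero, add_zero, smul_eq_mul] at h2
  exact (mul_eq_zero.mp h2).resolve_left hy0

/-- A domain that is finite over a subring with a nonzero derivation has a nonzero derivation. -/
theorem exists_derivation_ne_zero_of_finite {A R : Type*} [CommRing A] [IsDomain A] [CommRing R]
    [IsDomain R] [Algebra A R] [Module.Finite A R] (hinj : Function.Injective (algebraMap A R))
    (d : Derivation ℤ A A) (hd : d ≠ 0) : ∃ D : Derivation ℤ R R, D ≠ 0 := by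
  have : FaithfulSMul A R := (faithfulSMul_iff_algebraMap_injective A R).mpr hinj
  have hinjK : Function.Injective (algebraMap A (FractionRing R)) := by
    rw [IsScalarTower.algebraMap_eq A R (FractionRing R)]
    exact (IsFractionRing.injective R (FractionRing R)).comp hinj
  have : FaithfulSMul A (FractionRing R) :=
    (faithfulSMul_iff_algebraMap_injective _ _).mpr hinjK
  let _ : Algebra (FractionRing A) (FractionRing R) := FractionRing.liftAlgebra A (FractionRing R)
  have : IsScalarTower A (FractionRing A) (FractionRing R) :=
    FractionRing.isScalarTower_liftAlgebra A (FractionRing R)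
  have : Algebra.EssFiniteType R (FractionRing R) :=
    Algebra.EssFiniteType.of_isLocalization _ (nonZeroDivisors R)
  have : Algebra.EssFiniteType A (FractionRing R) := .comp A R _
  have : Algebra.EssFiniteType (FractionRing A) (FractionRing R) := .of_comp A _ _
  -- Separable case: the extension is formally étale and `d` extends uniquely. Inseparable case: a
  -- nonzero derivation over `FractionRing A` exists and kills `A`. Either way `A` is sent into `R`.
  by_cases hsep : Algebra.IsSeparable (FractionRing A) (FractionRing R)
  · have : Algebra.FormallyEtale (FractionRing A) (FractionRing R) := .of_isSeparable _ _
    have : Algebra.FormallyEtale A (FractionRing A) := .of_isLocalization (nonZeroDivisors A)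
    have : Algebra.FormallyEtale A (FractionRing R) := .comp A (FractionRing A) _
    let d' : Derivation ℤ A (FractionRing R) :=
      (Algebra.linearMap A (FractionRing R)).compDer d
    obtain ⟨D, hD⟩ := d'.exists_extension_of_formallyEtale
    have hD' : ∀ a, D (algebraMap A (FractionRing R) a) =
        algebraMap A (FractionRing R) (d a) := hD
    refine exists_derivation_ne_zero_of_fractionRing (A := A) (K := FractionRing R) D ?_ ?_
    · rintro rfl
      refine hd (Derivation.ext fun a => hinjK ?_)
      rw [← hD' a]
      simp
    · intro a
      rw [← IsScalarTower.algebraMap_apply, hD', IsScalarTower.algebraMap_apply A R]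
      exact ⟨_, rfl⟩
  · obtain ⟨D, hD⟩ := exists_derivation_ne_zero_of_not_isSeparable hsep
    obtain ⟨D', hD0, hD'⟩ := D.exists_int_eq hD
    refine exists_derivation_ne_zero_of_fractionRing (A := A) (K := FractionRing R) D' hD0 ?_
    intro a
    rw [← IsScalarTower.algebraMap_apply,
      IsScalarTower.algebraMap_apply A (FractionRing A) (FractionRing R), hD', D.map_algebraMap]
    exact zero_mem _

/-- A complete Noetherian local domain of equal characteristic and positive dimension has a nonzero
derivation. -/
theorem exists_derivation_ne_zero_of_isAdicComplete {R : Type*} [CommRing R] [IsDomain R]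
    [IsLocalRing R] [IsNoetherianRing R] [IsAdicComplete (IsLocalRing.maximalIdeal R) R]
    (hchar : ringChar R = ringChar (IsLocalRing.ResidueField R)) (hdim : 0 < ringKrullDim R) :
    ∃ D : Derivation ℤ R R, D ≠ 0 := by
  classical
  obtain ⟨s, Φ, hfin, hinj, hs⟩ := exists_finite_injective_mvPowerSeries hchar
  have hpos : 0 < s.card := by
    rw [← hs] at hdim
    exact_mod_cast hdim
  obtain ⟨i, hi⟩ := Finset.card_pos.mp hpos
  have : IsDomain (MvPowerSeries s (IsLocalRing.ResidueField R)) := NoZeroDivisors.to_isDomain _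
  let _ : Algebra (MvPowerSeries s (IsLocalRing.ResidueField R)) R := Φ.toAlgebra
  have : Module.Finite (MvPowerSeries s (IsLocalRing.ResidueField R)) R := hfin
  obtain ⟨d, hd0, -⟩ := (MvPowerSeries.pderiv (IsLocalRing.ResidueField R)
    (⟨i, hi⟩ : s)).exists_int_eq fun h0 => by
      have h1 := Derivation.congr_fun h0 (MvPowerSeries.X ⟨i, hi⟩)
      rw [MvPowerSeries.pderiv_X_self] at h1
      exact one_ne_zero h1
  exact exists_derivation_ne_zero_of_finite hinj d hd0

/-! ### Constants of a derivation and the conclusion -/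

/-- In a local ring of equal characteristic, every derivation has an infinite family of constants
whose differences lie only in primes containing a given element of the maximal ideal. -/
theorem exists_derivation_constants {R : Type*} [CommRing R] [IsLocalRing R]
    (hchar : ringChar R = ringChar (IsLocalRing.ResidueField R)) (D : Derivation ℤ R R)
    (b : R) (hb : b ∈ IsLocalRing.maximalIdeal R) :
    ∃ c : ℕ → R, (∀ n, D (c n) = 0) ∧
      ∀ p : Ideal R, p.IsPrime → ∀ m n, m ≠ n → c m - c n ∈ p → b ∈ p := by
  set ℓ := ringChar R with hℓ
  rcases eq_or_ne ℓ 0 with h0 | h0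
  · have : CharP (IsLocalRing.ResidueField R) 0 := ringChar.of_eq (hchar ▸ h0)
    have : CharZero (IsLocalRing.ResidueField R) := CharP.charP_to_charZero _
    -- In residue characteristic zero, distinct natural numbers differ by a unit, which lies in no
    -- prime.
    refine ⟨fun n => n, fun n => D.map_natCast n, fun p hp m n hmn h => ?_⟩
    have h1 := (IsLocalRing.residue_eq_zero_iff _).mpr (IsLocalRing.le_maximalIdeal hp.ne_top h)
    rw [map_sub, map_natCast, map_natCast, sub_eq_zero] at h1
    exact absurd (Nat.cast_injective h1) hmn
  -- In characteristic `ℓ`, `ℓ`-th powers are constants. Two of these powers of `b` differ, up to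
  -- sign, by a power of `b` times a unit `1 - b ^ e`.
  · refine ⟨fun n => b ^ (ℓ * (n + 1)), fun n => ?_, ?_⟩
    · rw [D.leibniz_pow, mul_smul, ← Nat.cast_smul_eq_nsmul R, hℓ, ringChar.Nat.cast_ringChar,
        zero_smul]
    · have key : ∀ p : Ideal R, p.IsPrime → ∀ m n, m < n →
          b ^ (ℓ * (m + 1)) - b ^ (ℓ * (n + 1)) ∈ p → b ∈ p := by
        intro p hp m n hmn h
        obtain ⟨e, he, he0⟩ : ∃ e, ℓ * (n + 1) = ℓ * (m + 1) + e ∧ e ≠ 0 := by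
          refine ⟨ℓ * (n - m), ?_, mul_ne_zero h0 (by omega)⟩
          rw [← mul_add]
          congr 1
          omega
        have h1 : b ^ (ℓ * (m + 1)) * (1 - b ^ e) ∈ p := by
          rwa [mul_sub, mul_one, ← pow_add, ← he]
        refine (hp.mem_or_mem h1).elim (hp.mem_of_pow_mem _) fun h2 => ?_
        refine absurd (p.eq_top_of_isUnit_mem h2 ?_) hp.ne_top
        exact IsLocalRing.isUnit_one_sub_self_of_mem_nonunits _
          ((IsLocalRing.mem_maximalIdeal _).mp (Ideal.pow_mem_of_mem _ hb e (by omega)))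
      intro p hp m n hmn h
      rcases lt_or_gt_of_ne hmn with hlt | hlt
      · exact key p hp m n hlt h
      · exact key p hp n m hlt (by rw [← neg_sub]; exact p.neg_mem h)

theorem mainTheorem8 {R : Type*} [CommRing R] [IsDomain R] [IsLocalRing R] [IsNoetherianRing R]
    [IsAdicComplete (IsLocalRing.maximalIdeal R) R] [IsIntegrallyClosed R]
    (hchar : ringChar R = ringChar (IsLocalRing.ResidueField R))
    (hdim : 2 ≤ ringKrullDim R)
    (r : ℕ) (q : Fin r → Ideal R) (hprime : ∀ i, (q i).IsPrime)
    (hheight : ∀ i, (q i).height = 1) :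
    ∃ x : ℕ → R,
      Function.Injective (fun n => Ideal.span ({x n} : Set R)) ∧
      ∀ n, x n ≠ 0 ∧ (∀ i, x n ∉ q i) ∧ IsReduced (R ⧸ Ideal.span ({x n} : Set R)) := by
  obtain ⟨D, hD⟩ := exists_derivation_ne_zero_of_isAdicComplete hchar
    (lt_of_lt_of_le (by decide) hdim)
  exact exists_reduced_sequence_of_derivation hdim D hD (exists_derivation_constants hchar D) q
    hprime fun i => (hheight i).le
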